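/- For Borel probability measures $\mu,\nu$ on $\mathbb R^2$ let $d^2(\mu,\nu)=\inf_\gamma \frac12\iint |x-y|^2\,d\gamma(x,y)$, where $\gamma$ ranges over the measures on $\mathbb R^2\times\mathbb R^2$ with marginals $\mu$ and $\nu$. Let $\rho_0$ be a Borel probability measure on $\mathbb R^2$ with compact support, and for a Borel probability measure $\mu$ on $\mathbb R^2$ with finite second moment put $$J[\mu]=\iint\log\frac1{|x-y|}\,d\mu(x)\,d\mu(y)+d^2(\mu,\rho_0)\in(-\infty,+\infty],$$ where the kernel has the value $+\infty$ for $x=y$. Then $J$ has a minimizer among all Borel probability measures on $\mathbb R^2$ with finite second moment. Every such minimizer $\rho$ has compact support and no atoms, and there is a Borel map $T:\mathbb R^2\to\mathbb R^2$ with $T_\#\rho=\rho_0$ which is optimal, that is, $\frac12\int|x-T(x)|^2\,d\rho(x)=d^2(\rho,\rho_0)$. -/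

import Mathlib

open MeasureTheory
open scoped ENNReal

noncomputable section

namespace LogTransport

/-- The Euclidean plane. -/
abbrev Plane : Type := EuclideanSpace ℝ (Fin 2)

/-- The kernel `log (1 / |x - y|)`, with the value `+∞` on the diagonal. -/
def logKernel (x y : Plane) : EReal := ENNReal.log (edist x y)⁻¹

theorem logKernel_self (x : Plane) : logKernel x x = ⊤ := by
  simp [logKernel]

theorem logKernel_of_ne {x y : Plane} (h : x ≠ y) :
    logKernel x y = ((Real.log (1 / ‖x - y‖) : ℝ) : EReal) := by
  have hpos : 0 < ‖x - y‖ := norm_pos_iff.mpr (sub_ne_zero.mpr h)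
  have h1 : (edist x y)⁻¹ = ENNReal.ofReal (1 / ‖x - y‖) := by
    rw [edist_dist, dist_eq_norm, ← ENNReal.ofReal_inv_of_pos hpos, one_div]
  rw [logKernel, h1, ENNReal.log_ofReal_of_pos (by positivity)]

/-- The logarithmic energy `∬ log (1 / |x - y|) dμ(x) dμ(y)`: the integral of the positive part of
the kernel minus the integral of its negative part. If `μ` is a probability measure with finite
second moment, then the second integral is finite, so that the difference is well defined in
`(-∞, +∞]`. -/
def logEnergy (μ : Measure Plane) : EReal :=
  ((∫⁻ p, (logKernel p.1 p.2).toENNReal ∂(μ.prod μ) : ℝ≥0∞) : EReal)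
    - ((∫⁻ p, (-logKernel p.1 p.2).toENNReal ∂(μ.prod μ) : ℝ≥0∞) : EReal)

/-- `γ` is a transport plan from `μ` to `ν`: a measure on the product with marginals `μ`, `ν`. -/
def IsTransportPlan (μ ν : Measure Plane) (γ : Measure (Plane × Plane)) : Prop :=
  γ.map Prod.fst = μ ∧ γ.map Prod.snd = ν

/-- The square of the 2-Wasserstein distance, normalized by the factor `1 / 2`:
the infimum of `(1 / 2) ∬ |x - y| ^ 2 dγ(x, y)` over the transport plans `γ` from `μ` to `ν`. -/
def wassersteinSq (μ ν : Measure Plane) : ℝ≥0∞ :=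
  ⨅ (γ : Measure (Plane × Plane)) (_ : IsTransportPlan μ ν γ),
    2⁻¹ * ∫⁻ p, edist p.1 p.2 ^ 2 ∂γ

/-- The functional `J[μ] = ∬ log (1 / |x - y|) dμ dμ + d²(μ, ρ₀)`. -/
def J (ρ₀ μ : Measure Plane) : EReal :=
  logEnergy μ + (wassersteinSq μ ρ₀ : EReal)

/-- The Wasserstein space of order 2: probability measures with finite second moment. -/
def P2 : Set (Measure Plane) :=
  {μ | IsProbabilityMeasure μ ∧ ∫⁻ x, ‖x‖ₑ ^ 2 ∂μ < ∞}

/-- `ρ` minimizes `J` among probability measures with finite second moment. -/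
def IsMinimizer (ρ₀ ρ : Measure Plane) : Prop :=
  ρ ∈ P2 ∧ ∀ μ ∈ P2, J ρ₀ ρ ≤ J ρ₀ μ

/-- `T` is an optimal transport map from `μ` to `ν`: it is measurable, pushes `μ` forward to `ν`,
and its cost `(1 / 2) ∫ |x - T x| ^ 2 dμ(x)` is the minimal transport cost. -/
def IsOptimalTransportMap (μ ν : Measure Plane) (T : Plane → Plane) : Prop :=
  MeasurePreserving T μ ν ∧ 2⁻¹ * ∫⁻ x, edist x (T x) ^ 2 ∂μ = wassersteinSq μ ν

end LogTransport

end

noncomputable section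

namespace LogTransport

open Set Filter Topology

/-! The problem is lifted from measures to plans. For a plan with second marginal `ρ₀`, logarithmic
energy plus transport cost equals, up to a constant depending only on `ρ₀`, a double integral of one
symmetric kernel, `planKernel`. The term `‖y‖ ^ 2 / 4` in `quad` sees only the fixed marginal, so it
costs nothing, but it makes the kernel nonnegative and coercive. Minimizing `J` thus amounts to
minimizing a quadratic form in `[0, ∞]` over plans (`minEnergy_add_logEnergyNeg`,
`isMinimizer_iff`), and existence follows from tightness and lower semicontinuity
(`exists_energy_le_of_isClosed`).

Let γ be an optimal plan. Spreading part of its mass over a circle, with the targets kept, is an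
admissible variation. The first variation bounds the potential at almost every `(x, y)` by its
average over any circle with the same target (`IsOptimalPlan.ae_potential_le_circle`). Shrinking the
circles shows that `x` minimizes `potential γ (·, y)` (`IsOptimalPlan.ae_potential_le`).

Apart from `quad (x, y)`, the potential is a constant plus a superharmonic function of `x`, so its
circle averages exceed the value at the centre by at most `r ^ 2 / 4`. If `x` had two targets, both
minimality conditions would force a convex kink at `x`, whose averages grow linearly in `r`. This is
impossible for small `r` (`eq_of_forall_potential_le`), so γ lies on a graph and the graph is the
optimal map. Finiteness of the potential excludes atoms, and its bound by one circle average gives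
compact support. -/

/-! ### The interaction kernel on plans and its coercivity. -/

/-- The part of the cost carried by one particle `x` with target `y`. -/
def quad (p : Plane × Plane) : ℝ := ‖p.1 - p.2‖ ^ 2 / 4 + ‖p.2‖ ^ 2 / 4 + 1

/-- The interaction of two particles of a plan, truncated at distance `ε`. -/
def kernelTrunc (ε : ℝ) (p q : Plane × Plane) : ℝ :=
  quad p + quad q - Real.log (max ‖p.1 - q.1‖ ε)

/-- The interaction of two particles of a plan; up to a constant, its double integral is the
logarithmic energy plus the transport cost. -/
def planKernel (p q : Plane × Plane) : ℝ≥0∞ :=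
  if p.1 = q.1 then ⊤ else ENNReal.ofReal (quad p + quad q - Real.log ‖p.1 - q.1‖)

theorem one_le_quad (p : Plane × Plane) : 1 ≤ quad p := by
  unfold quad; nlinarith [sq_nonneg ‖p.1 - p.2‖, sq_nonneg ‖p.2‖]

theorem quad_nonneg (p : Plane × Plane) : 0 ≤ quad p := zero_le_one.trans (one_le_quad p)

@[fun_prop]
theorem continuous_quad : Continuous quad := by
  unfold quad; fun_prop

theorem continuous_kernelTrunc {ε : ℝ} (hε : 0 < ε) :
    Continuous fun z : (Plane × Plane) × (Plane × Plane) ↦ kernelTrunc ε z.1 z.2 := by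
  unfold kernelTrunc
  refine Continuous.sub (by fun_prop) (Continuous.log (by fun_prop) fun z ↦ ?_)
  exact (lt_max_of_lt_right hε).ne'

theorem norm_sq_le_quad (p : Plane × Plane) : ‖p.1‖ ^ 2 ≤ 8 * quad p := by
  have h : ‖p.1‖ ≤ ‖p.1 - p.2‖ + ‖p.2‖ := by
    simpa using norm_add_le (p.1 - p.2) p.2
  have h0 := norm_nonneg p.1
  unfold quad
  nlinarith [sq_nonneg (‖p.1 - p.2‖ - ‖p.2‖)]

/-- Tangent line of the logarithm at `s ^ 2 = 16`. The factor 1/32 is what `norm_fst_sub_fst_sq_le`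
can absorb: a sum of four terms squared is at most four times the sum of squares, and 4/32 is half
of the 1/4 in `quad`. -/
theorem log_le_quad {s : ℝ} (hs : 0 < s) : Real.log s ≤ s ^ 2 / 32 + 1 := by
  have h1 : Real.log (s ^ 2 / 16) ≤ s ^ 2 / 16 - 1 := Real.log_le_sub_one_of_pos (by positivity)
  have h2 : Real.log (s ^ 2 / 16) = 2 * Real.log s - 4 * Real.log 2 := by
    rw [Real.log_div (by positivity) (by norm_num), Real.log_pow,
      show (16 : ℝ) = 2 ^ 4 by norm_num, Real.log_pow]
    push_cast; ring
  have h3 := Real.log_two_lt_d9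
  nlinarith

theorem norm_fst_sub_fst_sq_le (p q : Plane × Plane) :
    ‖p.1 - q.1‖ ^ 2 / 32 + 1 ≤ (quad p + quad q) / 2 := by
  have h1 : ‖p.1 - q.1‖ ≤ ‖p.1 - p.2‖ + ‖p.2‖ + (‖q.1 - q.2‖ + ‖q.2‖) := by
    have h : p.1 - q.1 = ((p.1 - p.2) + p.2) - ((q.1 - q.2) + q.2) := by abel
    rw [h]
    exact (norm_sub_le _ _).trans (add_le_add (norm_add_le _ _) (norm_add_le _ _))
  have h2 : ‖p.1 - q.1‖ ^ 2 ≤ (‖p.1 - p.2‖ + ‖p.2‖ + (‖q.1 - q.2‖ + ‖q.2‖)) ^ 2 := by gcongr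
  unfold quad
  generalize ‖p.1 - p.2‖ = a at *
  generalize ‖p.2‖ = b at *
  generalize ‖q.1 - q.2‖ = c at *
  generalize ‖q.2‖ = d at *
  nlinarith [sq_nonneg (a - b), sq_nonneg (a - c), sq_nonneg (a - d), sq_nonneg (b - c),
    sq_nonneg (b - d), sq_nonneg (c - d)]

theorem quad_add_le_kernelTrunc {ε : ℝ} (h0 : 0 < ε) (h1 : ε ≤ 1) (p q : Plane × Plane) :
    (quad p + quad q) / 2 ≤ kernelTrunc ε p q := by
  have h : Real.log (max ‖p.1 - q.1‖ ε) ≤ (quad p + quad q) / 2 := by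
    rcases le_total ‖p.1 - q.1‖ ε with h | h
    · rw [max_eq_right h]
      have := Real.log_nonpos h0.le h1
      linarith [quad_nonneg p, quad_nonneg q]
    · rw [max_eq_left h]
      exact (log_le_quad (h0.trans_le h)).trans (norm_fst_sub_fst_sq_le p q)
  unfold kernelTrunc; linarith

theorem ofReal_kernelTrunc_le (ε : ℝ) (p q : Plane × Plane) :
    ENNReal.ofReal (kernelTrunc ε p q) ≤ planKernel p q := by
  unfold planKernel kernelTrunc
  split_ifs with h
  · exact le_top
  · have : 0 < ‖p.1 - q.1‖ := norm_pos_iff.2 (sub_ne_zero.2 h)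
    gcongr
    exact le_max_left _ _

theorem quad_add_le_planKernel (p q : Plane × Plane) :
    ENNReal.ofReal ((quad p + quad q) / 2) ≤ planKernel p q :=
  (ENNReal.ofReal_le_ofReal (quad_add_le_kernelTrunc one_pos le_rfl p q)).trans
    (ofReal_kernelTrunc_le 1 p q)

theorem quad_le_planKernel (p q : Plane × Plane) :
    ENNReal.ofReal (quad p / 2) ≤ planKernel p q :=
  (ENNReal.ofReal_le_ofReal (by linarith [quad_nonneg q])).trans (quad_add_le_planKernel p q)

theorem planKernel_comm (p q : Plane × Plane) : planKernel p q = planKernel q p := by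
  unfold planKernel
  simp only [eq_comm (a := p.1), norm_sub_rev p.1, add_comm (quad p)]

/-- Monotone approximation by continuous kernels; both measurability and lower semicontinuity rest
on it. -/
theorem planKernel_eq_iSup (p q : Plane × Plane) :
    planKernel p q = ⨆ n : ℕ, ENNReal.ofReal (kernelTrunc (1 / ((n : ℝ) + 1)) p q) := by
  apply le_antisymm
  · by_cases h : p.1 = q.1
    · have h1 : Tendsto (fun n : ℕ ↦ ENNReal.ofReal (kernelTrunc (1 / ((n : ℝ) + 1)) p q)) atTop
          (𝓝 ⊤) := by
        refine ENNReal.tendsto_ofReal_nhds_top.2 ?_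
        have h2 : (fun n : ℕ ↦ kernelTrunc (1 / ((n : ℝ) + 1)) p q) =
            fun n : ℕ ↦ (quad p + quad q) + Real.log ((n : ℝ) + 1) := by
          ext n
          have : (0 : ℝ) ≤ ((n : ℝ) + 1)⁻¹ := by positivity
          simp [kernelTrunc, h, this]
        rw [h2]
        exact tendsto_atTop_add_const_left _ _ (Real.tendsto_log_atTop.comp
          (tendsto_atTop_add_const_right _ _ tendsto_natCast_atTop_atTop))
      rw [planKernel, if_pos h]
      exact le_of_tendsto h1 (Eventually.of_forall fun n ↦ le_iSup
        (fun n : ℕ ↦ ENNReal.ofReal (kernelTrunc (1 / ((n : ℝ) + 1)) p q)) n)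
    · have hpos : 0 < ‖p.1 - q.1‖ := norm_pos_iff.2 (sub_ne_zero.2 h)
      obtain ⟨n, hn⟩ := exists_nat_one_div_lt hpos
      refine le_iSup_of_le n ?_
      rw [planKernel, if_neg h, kernelTrunc, max_eq_left hn.le]
  · exact iSup_le fun n ↦ ofReal_kernelTrunc_le _ p q

theorem measurable_planKernel :
    Measurable fun z : (Plane × Plane) × (Plane × Plane) ↦ planKernel z.1 z.2 := by
  simp_rw [planKernel_eq_iSup]
  exact Measurable.iSup fun n ↦
    (continuous_kernelTrunc Nat.one_div_pos_of_nat).measurable.ennreal_ofReal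

/-- Changing the target of a particle at `x` affects only its own `quad` term. The additive form
remains valid when the kernel is infinite. -/
theorem planKernel_add_quad (x y y' : Plane) (q : Plane × Plane) :
    planKernel (x, y) q + ENNReal.ofReal (quad (x, y')) =
      planKernel (x, y') q + ENNReal.ofReal (quad (x, y)) := by
  by_cases h : x = q.1
  · simp [planKernel, h]
  · have hx : 0 < ‖x - q.1‖ := norm_pos_iff.2 (sub_ne_zero.2 h)
    have h1 : ∀ y, 0 ≤ quad (x, y) + quad q - Real.log ‖x - q.1‖ := fun y ↦ by
      have h2 := (log_le_quad hx).trans (norm_fst_sub_fst_sq_le (x, y) q)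
      linarith [quad_nonneg (x, y), quad_nonneg q]
    simp only [planKernel, h, if_false]
    rw [← ENNReal.ofReal_add (h1 _) (quad_nonneg _), ← ENNReal.ofReal_add (h1 _) (quad_nonneg _)]
    congr 1; ring

/-! ### Potential and mutual energy of plans. -/

/-- The potential generated by a plan. -/
def potential (γ : Measure (Plane × Plane)) (p : Plane × Plane) : ℝ≥0∞ :=
  ∫⁻ q, planKernel p q ∂γ

/-- The mutual energy of two plans. -/
def energy (γ σ : Measure (Plane × Plane)) : ℝ≥0∞ := ∫⁻ p, potential σ p ∂γ

theorem measurable_potential (γ : Measure (Plane × Plane)) [SFinite γ] :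
    Measurable (potential γ) :=
  measurable_planKernel.lintegral_prod_right'

theorem energy_eq_lintegral_prod (γ σ : Measure (Plane × Plane)) [SFinite γ] [SFinite σ] :
    energy γ σ = ∫⁻ z, planKernel z.1 z.2 ∂(γ.prod σ) :=
  (lintegral_prod _ measurable_planKernel.aemeasurable).symm

theorem energy_comm (γ σ : Measure (Plane × Plane)) [SFinite γ] [SFinite σ] :
    energy γ σ = energy σ γ := by
  unfold energy potential
  rw [lintegral_lintegral_swap measurable_planKernel.aemeasurable]
  simp_rw [planKernel_comm]

theorem energy_add_left (γ γ' σ : Measure (Plane × Plane)) :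
    energy (γ + γ') σ = energy γ σ + energy γ' σ := lintegral_add_measure _ _ _

theorem energy_add_right (γ σ σ' : Measure (Plane × Plane)) [SFinite γ] [SFinite σ] [SFinite σ'] :
    energy γ (σ + σ') = energy γ σ + energy γ σ' := by
  rw [energy_comm, energy_add_left, energy_comm σ, energy_comm σ']

theorem energy_smul_left (c : ℝ≥0∞) (γ σ : Measure (Plane × Plane)) :
    energy (c • γ) σ = c * energy γ σ := lintegral_smul_measure _ _

theorem energy_smul_right (c : ℝ≥0∞) (γ σ : Measure (Plane × Plane)) [SFinite σ] :
    energy γ (c • σ) = c * energy γ σ := by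
  unfold energy potential
  simp_rw [lintegral_smul_measure, smul_eq_mul]
  exact lintegral_const_mul _ (measurable_potential σ)

theorem energy_mono {γ γ' σ σ' : Measure (Plane × Plane)} (h : γ ≤ γ') (h' : σ ≤ σ') :
    energy γ σ ≤ energy γ' σ' :=
  lintegral_mono' h fun _ ↦ lintegral_mono' h' le_rfl

theorem lintegral_quad_le_energy (γ : Measure (Plane × Plane)) [IsProbabilityMeasure γ] :
    ∫⁻ p, ENNReal.ofReal (quad p / 2) ∂γ ≤ energy γ γ := by
  refine lintegral_mono fun p ↦ ?_
  calc ENNReal.ofReal (quad p / 2) = ∫⁻ _, ENNReal.ofReal (quad p / 2) ∂γ := by simp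
    _ ≤ potential γ p := lintegral_mono fun q ↦ quad_le_planKernel p q

theorem lintegral_quad_lt_top {γ : Measure (Plane × Plane)} [IsProbabilityMeasure γ]
    (h : energy γ γ < ∞) : ∫⁻ p, ENNReal.ofReal (quad p) ∂γ < ∞ := by
  have h1 : ∀ p, ENNReal.ofReal (quad p) = 2 * ENNReal.ofReal (quad p / 2) := fun p ↦ by
    rw [← ENNReal.ofReal_ofNat 2, ← ENNReal.ofReal_mul (by norm_num)]
    congr 1; ring
  simp_rw [h1]
  rw [lintegral_const_mul _ (by fun_prop)]
  exact ENNReal.mul_lt_top (by simp) ((lintegral_quad_le_energy γ).trans_lt h)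

/-! ### Averages over circles. -/

/-- The identification of the plane with `ℂ`. -/
def planeEquiv : ℂ ≃ₗᵢ[ℝ] Plane := Complex.orthonormalBasisOneI.repr

/-- The parametrization of the circle with center `z` and radius `r`. -/
def circlePoint (z : Plane) (r θ : ℝ) : Plane := planeEquiv (circleMap (planeEquiv.symm z) r θ)

/-- The uniform probability measure on the angles of a circle. -/
def angleMeasure : Measure ℝ :=
  ENNReal.ofReal (2 * Real.pi)⁻¹ • volume.restrict (Ioc 0 (2 * Real.pi))

/-- The uniform probability measure on a circle. -/
def circleMeasure (z : Plane) (r : ℝ) : Measure Plane := angleMeasure.map (circlePoint z r)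

instance : IsProbabilityMeasure angleMeasure := by
  constructor
  have := Real.pi_pos
  rw [angleMeasure, Measure.smul_apply, Measure.restrict_apply_univ, Real.volume_Ioc, smul_eq_mul,
    ← ENNReal.ofReal_mul (by positivity), sub_zero, inv_mul_cancel₀ (by positivity),
    ENNReal.ofReal_one]

@[fun_prop]
theorem continuous_circlePoint (z : Plane) (r : ℝ) : Continuous (circlePoint z r) :=
  planeEquiv.continuous.comp (continuous_circleMap _ _)

instance (z : Plane) (r : ℝ) : IsProbabilityMeasure (circleMeasure z r) :=
  Measure.isProbabilityMeasure_map (continuous_circlePoint z r).aemeasurable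

theorem lintegral_circleMeasure {f : Plane → ℝ≥0∞} (hf : Measurable f) (z : Plane) (r : ℝ) :
    ∫⁻ x, f x ∂(circleMeasure z r) = ∫⁻ θ, f (circlePoint z r θ) ∂angleMeasure :=
  lintegral_map hf (continuous_circlePoint z r).measurable

theorem integral_angleMeasure (f : ℝ → ℝ) :
    ∫ θ, f θ ∂angleMeasure = (2 * Real.pi)⁻¹ * ∫ θ in 0..2 * Real.pi, f θ := by
  have := Real.pi_pos
  rw [angleMeasure, integral_smul_measure, intervalIntegral.integral_of_le (by positivity),
    ENNReal.toReal_ofReal (by positivity), smul_eq_mul]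

theorem integrable_angleMeasure {f : ℝ → ℝ}
    (hf : IntervalIntegrable f volume 0 (2 * Real.pi)) : Integrable f angleMeasure := by
  have := Real.pi_pos
  rw [intervalIntegrable_iff_integrableOn_Ioc_of_le (by positivity)] at hf
  exact Integrable.smul_measure hf (by simp)

theorem norm_circlePoint_sub (z x : Plane) (r θ : ℝ) :
    ‖circlePoint z r θ - x‖ = ‖circleMap (planeEquiv.symm z) r θ - planeEquiv.symm x‖ := by
  rw [circlePoint, ← planeEquiv.symm.norm_map, map_sub, planeEquiv.symm_apply_apply]

theorem norm_circlePoint_sub_self (z : Plane) (r θ : ℝ) : ‖circlePoint z r θ - z‖ = |r| := by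
  rw [norm_circlePoint_sub, circleMap_sub_center]
  simp [circleMap]

theorem inner_circlePoint_sub_self (z w : Plane) (r θ : ℝ) :
    inner ℝ (circlePoint z r θ - z) w =
      r * ((planeEquiv.symm w).re * Real.cos θ + (planeEquiv.symm w).im * Real.sin θ) := by
  rw [← planeEquiv.symm.inner_map_map, map_sub, circlePoint, planeEquiv.symm_apply_apply,
    circleMap_sub_center, Complex.inner]
  simp [circleMap, Complex.exp_re, Complex.exp_im]
  ring

theorem integral_inner_circlePoint (z w : Plane) (r : ℝ) :
    ∫ θ, inner ℝ (circlePoint z r θ - z) w ∂angleMeasure = 0 := by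
  simp_rw [inner_circlePoint_sub_self]
  rw [integral_angleMeasure, intervalIntegral.integral_const_mul, intervalIntegral.integral_add
    (by apply Continuous.intervalIntegrable; fun_prop)
    (by apply Continuous.intervalIntegrable; fun_prop)]
  simp

theorem integral_inner_sq_circlePoint (z w : Plane) (r : ℝ) :
    ∫ θ, (inner ℝ (circlePoint z r θ - z) w : ℝ) ^ 2 ∂angleMeasure = r ^ 2 * ‖w‖ ^ 2 / 2 := by
  have hw : ‖w‖ ^ 2 = (planeEquiv.symm w).re ^ 2 + (planeEquiv.symm w).im ^ 2 := by
    rw [← planeEquiv.symm.norm_map, Complex.sq_norm, Complex.normSq_apply]; ring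
  simp_rw [inner_circlePoint_sub_self, hw]
  generalize (planeEquiv.symm w).re = a
  generalize (planeEquiv.symm w).im = b
  have h : ∀ θ : ℝ, (r * (a * Real.cos θ + b * Real.sin θ)) ^ 2 =
      r ^ 2 * a ^ 2 * Real.cos θ ^ 2 + r ^ 2 * b ^ 2 * Real.sin θ ^ 2 +
        2 * r ^ 2 * a * b * (Real.sin θ * Real.cos θ) := fun θ ↦ by ring
  simp_rw [h]
  rw [integral_angleMeasure, intervalIntegral.integral_add
    (by apply Continuous.intervalIntegrable; fun_prop)
    (by apply Continuous.intervalIntegrable; fun_prop), intervalIntegral.integral_add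
    (by apply Continuous.intervalIntegrable; fun_prop)
    (by apply Continuous.intervalIntegrable; fun_prop)]
  simp only [intervalIntegral.integral_const_mul, integral_cos_sq, integral_sin_sq,
    integral_sin_mul_cos₁]
  have := Real.pi_ne_zero
  simp
  field_simp

theorem quad_circlePoint (z y : Plane) (r θ : ℝ) :
    quad (circlePoint z r θ, y) =
      quad (z, y) + r ^ 2 / 4 + inner ℝ (circlePoint z r θ - z) (z - y) / 2 := by
  have h : circlePoint z r θ - y = (circlePoint z r θ - z) + (z - y) := by abel
  simp only [quad]
  rw [h, norm_add_sq_real, norm_circlePoint_sub_self, sq_abs]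
  ring

theorem ae_circlePoint_ne (z x : Plane) {r : ℝ} (hr : r ≠ 0) :
    ∀ᵐ θ ∂angleMeasure, circlePoint z r θ ≠ x := by
  have h : (circlePoint z r ⁻¹' {x}).Countable := by
    have : circlePoint z r ⁻¹' {x} = circleMap (planeEquiv.symm z) r ⁻¹' {planeEquiv.symm x} := by
      ext θ
      simp [circlePoint, LinearIsometryEquiv.eq_symm_apply]
    rw [this]
    exact (countable_singleton _).preimage_circleMap _ hr
  have h0 : volume (circlePoint z r ⁻¹' {x}) = 0 := h.measure_zero _
  rw [ae_iff]
  simp only [ne_eq, not_not]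
  exact Measure.smul_absolutelyContinuous
    (Measure.absolutelyContinuous_of_le Measure.restrict_le_self h0)

theorem integrable_log_circlePoint (z x : Plane) (r : ℝ) :
    Integrable (fun θ ↦ Real.log ‖circlePoint z r θ - x‖) angleMeasure := by
  simp_rw [norm_circlePoint_sub]
  exact integrable_angleMeasure (circleIntegrable_log_norm_sub_const r)

/-- Newton's theorem in the plane, a case of Jensen's formula: averaging over a circle of radius `r`
truncates the logarithm at `r`. This is why `kernelTrunc` is cut off by a maximum. -/
theorem integral_log_circlePoint (z x : Plane) {r : ℝ} (hr : 0 < r) :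
    ∫ θ, Real.log ‖circlePoint z r θ - x‖ ∂angleMeasure = Real.log (max ‖z - x‖ r) := by
  simp_rw [norm_circlePoint_sub]
  rw [integral_angleMeasure]
  have h := circleAverage_log_norm_sub_const_eq_log_radius_add_posLog
    (c := planeEquiv.symm z) (a := planeEquiv.symm x) hr.ne'
  rw [Real.circleAverage_def, smul_eq_mul] at h
  rw [h, ← map_sub, planeEquiv.symm.norm_map]
  rcases le_or_gt ‖z - x‖ r with h1 | h1
  · rw [max_eq_right h1, add_eq_left, Real.posLog_eq_zero_iff, abs_of_nonneg (by positivity),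
      inv_mul_le_iff₀ hr, mul_one]
    exact h1
  · rw [max_eq_left h1.le, Real.posLog_eq_log, Real.log_mul (by positivity)
      (by linarith), Real.log_inv]
    · ring
    · rw [abs_of_nonneg (by positivity), le_inv_mul_iff₀ hr]
      linarith

theorem lintegral_planKernel_circlePoint (z y : Plane) {r : ℝ} (hr : 0 < r) (q : Plane × Plane) :
    ∫⁻ θ, planKernel (circlePoint z r θ, y) q ∂angleMeasure =
      ENNReal.ofReal (kernelTrunc r (z, y) q + r ^ 2 / 4) := by
  have hi : Continuous fun θ ↦ (inner ℝ (circlePoint z r θ - z) (z - y) : ℝ) / 2 := by fun_prop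
  have hi' : Integrable (fun θ ↦ (inner ℝ (circlePoint z r θ - z) (z - y) : ℝ) / 2)
      angleMeasure := integrable_angleMeasure (hi.intervalIntegrable _ _)
  have hl := integrable_log_circlePoint z q.1 r
  have h : ∀ᵐ θ ∂angleMeasure, planKernel (circlePoint z r θ, y) q = ENNReal.ofReal
      ((quad (z, y) + r ^ 2 / 4 + quad q) + inner ℝ (circlePoint z r θ - z) (z - y) / 2 -
        Real.log ‖circlePoint z r θ - q.1‖) := by
    filter_upwards [ae_circlePoint_ne z q.1 hr.ne'] with θ hθ
    rw [planKernel, if_neg hθ, quad_circlePoint]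
    congr 1; ring
  rw [lintegral_congr_ae h, ← ofReal_integral_eq_lintegral_ofReal]
  · have hc : Integrable (fun θ ↦ (quad (z, y) + r ^ 2 / 4 + quad q) +
        inner ℝ (circlePoint z r θ - z) (z - y) / 2) angleMeasure := (integrable_const _).add hi'
    rw [integral_sub hc hl, integral_add (integrable_const _) hi', integral_log_circlePoint z q.1 hr,
      integral_div, integral_inner_circlePoint, integral_const]
    congr 1
    simp [kernelTrunc]
    ring
  · exact ((integrable_const _).add hi').sub hl
  · filter_upwards [ae_circlePoint_ne z q.1 hr.ne'] with θ hθ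
    have h1 := (log_le_quad (norm_pos_iff.2 (sub_ne_zero.2 hθ))).trans
      (norm_fst_sub_fst_sq_le (circlePoint z r θ, y) q)
    have h2 := quad_circlePoint z y r θ
    have h3 := quad_nonneg (circlePoint z r θ, y)
    have h4 := quad_nonneg q
    simp only [Pi.zero_apply]
    linarith

theorem lintegral_potential_circlePoint (γ : Measure (Plane × Plane)) [SFinite γ]
    (z y : Plane) {r : ℝ} (hr : 0 < r) :
    ∫⁻ θ, potential γ (circlePoint z r θ, y) ∂angleMeasure =
      ∫⁻ q, ENNReal.ofReal (kernelTrunc r (z, y) q + r ^ 2 / 4) ∂γ := by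
  unfold potential
  rw [lintegral_lintegral_swap]
  · simp_rw [lintegral_planKernel_circlePoint z y hr]
  · have h : Measurable fun a : ℝ × (Plane × Plane) ↦ ((circlePoint z r a.1, y), a.2) :=
      Continuous.measurable (by fun_prop)
    exact (measurable_planKernel.comp h).aemeasurable

/-- The logarithmic part is superharmonic, and the average of `quad` exceeds its central value by
exactly `r ^ 2 / 4`. -/
theorem lintegral_potential_circlePoint_le (γ : Measure (Plane × Plane)) [IsProbabilityMeasure γ]
    (z y : Plane) {r : ℝ} (hr : 0 < r) :
    ∫⁻ θ, potential γ (circlePoint z r θ, y) ∂angleMeasure ≤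
      potential γ (z, y) + ENNReal.ofReal (r ^ 2 / 4) := by
  rw [lintegral_potential_circlePoint γ z y hr]
  calc _ ≤ ∫⁻ q, (planKernel (z, y) q + ENNReal.ofReal (r ^ 2 / 4)) ∂γ :=
        lintegral_mono fun q ↦ ENNReal.ofReal_add_le.trans
          (add_le_add_left (ofReal_kernelTrunc_le _ _ _) _)
    _ = _ := by rw [lintegral_add_right _ measurable_const]; simp [potential]

/-! ### Lower semicontinuity, tightness and existence of minimizing plans. -/

theorem lowerSemicontinuous_lintegral_ofReal {Z : Type*} [TopologicalSpace Z] [MeasurableSpace Z]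
    [OpensMeasurableSpace Z] {f : Z → ℝ} (hf : Continuous f) :
    LowerSemicontinuous fun γ : ProbabilityMeasure Z ↦
      ∫⁻ z, ENNReal.ofReal (f z) ∂(γ : Measure Z) := by
  have h : ∀ γ : ProbabilityMeasure Z, ∫⁻ z, ENNReal.ofReal (f z) ∂(γ : Measure Z) =
      ⨆ n : ℕ, ∫⁻ z, ENNReal.ofReal (min (f z) n) ∂(γ : Measure Z) := fun γ ↦ by
    rw [← lintegral_iSup (fun n ↦ by fun_prop) fun n m h z ↦ by gcongr]
    refine lintegral_congr fun z ↦ le_antisymm ?_ (iSup_le fun n ↦ by gcongr; exact min_le_left _ _)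
    obtain ⟨n, hn⟩ := exists_nat_ge (f z)
    exact le_iSup_of_le n (by rw [min_eq_left hn])
  simp_rw [h]
  refine lowerSemicontinuous_iSup fun n ↦ Continuous.lowerSemicontinuous ?_
  let g : BoundedContinuousFunction Z NNReal := BoundedContinuousFunction.mkOfBound
    ⟨fun z ↦ (min (f z) n).toNNReal, by fun_prop⟩ n fun x y ↦ by
      have h1 : ∀ z, ((min (f z) n).toNNReal : ℝ) ≤ n := fun z ↦ by
        simp [Real.coe_toNNReal']
      rw [NNReal.dist_eq]
      exact abs_sub_le_of_nonneg_of_le (NNReal.coe_nonneg _) (h1 x) (NNReal.coe_nonneg _) (h1 y)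
  exact ProbabilityMeasure.continuous_lintegral_boundedContinuousFunction g

theorem lowerSemicontinuous_energy :
    LowerSemicontinuous fun γ : ProbabilityMeasure (Plane × Plane) ↦
      energy (γ : Measure (Plane × Plane)) γ := by
  have h : ∀ γ : ProbabilityMeasure (Plane × Plane), energy (γ : Measure (Plane × Plane)) γ =
      ⨆ n : ℕ, ∫⁻ z, ENNReal.ofReal (kernelTrunc (1 / ((n : ℝ) + 1)) z.1 z.2)
        ∂((γ.prod γ : ProbabilityMeasure _) : Measure ((Plane × Plane) × (Plane × Plane))) :=
    fun γ ↦ by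
      rw [energy_eq_lintegral_prod, ← lintegral_iSup]
      · simp_rw [planKernel_eq_iSup]; rfl
      · exact fun n ↦
          (continuous_kernelTrunc Nat.one_div_pos_of_nat).measurable.ennreal_ofReal
      · intro n m hnm z
        simp only [kernelTrunc]
        have h1 : (0 : ℝ) < 1 / ((m : ℝ) + 1) := Nat.one_div_pos_of_nat
        have h2 : 0 < max ‖z.1.1 - z.2.1‖ (1 / ((m : ℝ) + 1)) := lt_max_of_lt_right h1
        gcongr
  simp_rw [h]
  refine lowerSemicontinuous_iSup fun n ↦ ?_
  exact (lowerSemicontinuous_lintegral_ofReal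
    (continuous_kernelTrunc Nat.one_div_pos_of_nat)).comp
    (ProbabilityMeasure.continuous_prod.comp (continuous_id.prodMk continuous_id))

theorem isCompact_quad_le (R : ℝ) : IsCompact {p | quad p ≤ R} := by
  refine Metric.isCompact_of_isClosed_isBounded (isClosed_le continuous_quad continuous_const) ?_
  refine (Metric.isBounded_closedBall (x := (0 : Plane × Plane)) (r := 8 * R)).subset fun p hp ↦ ?_
  have h1 := norm_sq_le_quad p
  have h2 := one_le_quad p
  simp only [mem_ofPred_eq] at hp
  have h3 : ‖p.2‖ ^ 2 ≤ 4 * quad p := by unfold quad; nlinarith [sq_nonneg ‖p.1 - p.2‖]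
  rw [mem_closedBall_zero_iff, Prod.norm_def, max_le_iff]
  constructor <;> nlinarith [norm_nonneg p.1, norm_nonneg p.2]

/-- Markov's inequality for `quad`, whose sublevel sets are compact and whose integral the energy
controls. -/
theorem isTightMeasureSet_energy_le {M : ℝ≥0∞} (hM : M ≠ ∞) :
    IsTightMeasureSet {γ : Measure (Plane × Plane) | IsProbabilityMeasure γ ∧ energy γ γ ≤ M} := by
  rw [isTightMeasureSet_iff_exists_isCompact_measure_compl_le]
  intro ε hε
  obtain ⟨R, hR0, hR⟩ : ∃ R : ℝ, 0 < R ∧ M / ENNReal.ofReal (R / 2) ≤ ε := by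
    have : Tendsto (fun R : ℝ ↦ M / ENNReal.ofReal (R / 2)) atTop (𝓝 0) := by
      have h := ENNReal.Tendsto.const_div (a := M) (ENNReal.tendsto_ofReal_nhds_top.2
        (tendsto_id.atTop_div_const (two_pos : (0 : ℝ) < 2))) (Or.inr hM)
      simpa using h
    have h := (eventually_gt_atTop (0 : ℝ)).and (this.eventually (eventually_le_nhds hε))
    exact h.exists
  refine ⟨_, isCompact_quad_le R, fun γ ⟨hγ, hE⟩ ↦ ?_⟩
  refine le_trans ?_ hR
  rw [ENNReal.le_div_iff_mul_le (Or.inl (by simpa using hR0)) (Or.inl ENNReal.ofReal_ne_top),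
    mul_comm]
  refine le_trans ?_ ((lintegral_quad_le_energy γ).trans hE)
  refine le_trans ?_ (mul_meas_ge_le_lintegral (by fun_prop) (ENNReal.ofReal (R / 2)))
  gcongr
  intro p hp
  simp only [mem_compl_iff, mem_ofPred_eq, not_le] at hp ⊢
  gcongr

/-- The direct method. It serves twice: with only the target marginal fixed, and with both marginals
fixed. -/
theorem exists_energy_le_of_isClosed {C : Set (ProbabilityMeasure (Plane × Plane))}
    (hC : IsClosed C) (hne : C.Nonempty) :
    ∃ γ ∈ C, ∀ σ ∈ C, energy (γ : Measure (Plane × Plane)) γ ≤ energy (σ : Measure _) σ := by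
  by_cases htop : ∀ σ ∈ C, energy (σ : Measure (Plane × Plane)) σ = ∞
  · obtain ⟨γ, hγ⟩ := hne
    exact ⟨γ, hγ, fun σ hσ ↦ by simp [htop σ hσ]⟩
  push Not at htop
  obtain ⟨σ₀, hσ₀, hfin⟩ := htop
  set S : Set (ProbabilityMeasure (Plane × Plane)) :=
    {σ | energy (σ : Measure (Plane × Plane)) σ ≤ energy (σ₀ : Measure (Plane × Plane)) σ₀}
  have hS : IsClosed S := lowerSemicontinuous_energy.isClosed_preimage _
  have hScomp : IsCompact S := by
    rw [← hS.closure_eq]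
    refine isCompact_closure_of_isTightMeasureSet
      ((isTightMeasureSet_energy_le hfin).subset ?_)
    rintro _ ⟨σ, hσ, rfl⟩
    exact ⟨inferInstance, hσ⟩
  obtain ⟨γ, hγ, hmin⟩ := LowerSemicontinuousOn.exists_isMinOn (s := C ∩ S)
    ⟨σ₀, hσ₀, le_refl (energy (σ₀ : Measure (Plane × Plane)) σ₀)⟩ (hScomp.inter_left hC)
    (lowerSemicontinuous_energy.lowerSemicontinuousOn _)
  refine ⟨γ, hγ.1, fun σ hσ ↦ ?_⟩
  by_cases h : σ ∈ S
  · exact hmin ⟨hσ, h⟩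
  · exact hγ.2.trans (not_le.1 h).le

theorem isClosed_map_eq {Y Z : Type*} [TopologicalSpace Y] [MeasurableSpace Y] [BorelSpace Y]
    [TopologicalSpace Z] [MeasurableSpace Z] [BorelSpace Z] [HasOuterApproxClosed Z]
    {f : Y → Z} (hf : Continuous f) (ν : Measure Z) [IsProbabilityMeasure ν] :
    IsClosed {γ : ProbabilityMeasure Y | (γ : Measure Y).map f = ν} := by
  convert isClosed_eq (ProbabilityMeasure.continuous_map hf)
    (continuous_const (y := (⟨ν, inferInstance⟩ : ProbabilityMeasure Z))) using 1
  ext γ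
  simp only [mem_ofPred_eq]
  exact ⟨fun h ↦ Subtype.ext h, fun h ↦ congrArg Subtype.val h⟩

/-! ### From the functional on measures to the energy of plans. -/

/-- The positive part of the logarithmic energy. -/
def logEnergyPos (μ : Measure Plane) : ℝ≥0∞ :=
  ∫⁻ p, (logKernel p.1 p.2).toENNReal ∂(μ.prod μ)

/-- The negative part of the logarithmic energy. -/
def logEnergyNeg (μ : Measure Plane) : ℝ≥0∞ :=
  ∫⁻ p, (-logKernel p.1 p.2).toENNReal ∂(μ.prod μ)

/-- The difference between the energy of a plan to `ρ₀` and the logarithmic energy of its first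
marginal plus its transport cost. -/
def targetMoment (ρ₀ : Measure Plane) : ℝ≥0∞ :=
  2⁻¹ * ∫⁻ y, ‖y‖ₑ ^ 2 ∂ρ₀ + 2

/-- The least energy of a transport plan from `μ` to `ρ₀`. -/
def minEnergy (ρ₀ μ : Measure Plane) : ℝ≥0∞ :=
  ⨅ (γ : Measure (Plane × Plane)) (_ : IsTransportPlan μ ρ₀ γ), energy γ γ

theorem measurable_logKernel : Measurable fun p : Plane × Plane ↦ logKernel p.1 p.2 := by
  unfold logKernel
  exact ENNReal.measurable_log.comp (by fun_prop)

theorem toENNReal_logKernel_of_ne {x y : Plane} (h : x ≠ y) :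
    (logKernel x y).toENNReal = ENNReal.ofReal (-Real.log ‖x - y‖) ∧
      (-logKernel x y).toENNReal = ENNReal.ofReal (Real.log ‖x - y‖) := by
  rw [logKernel_of_ne h, one_div, Real.log_inv, ← EReal.coe_neg, neg_neg]
  exact ⟨EReal.toENNReal_of_ne_top (by simp), EReal.toENNReal_of_ne_top (by simp)⟩

/-- The kernel is split with the negative part of the logarithmic kernel moved to the left, so that
the identity integrates in `ℝ≥0∞` without subtraction. -/
theorem planKernel_add_logKernel (p q : Plane × Plane) :
    planKernel p q + (-logKernel p.1 q.1).toENNReal =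
      (logKernel p.1 q.1).toENNReal + (ENNReal.ofReal (quad p) + ENNReal.ofReal (quad q)) := by
  by_cases h : p.1 = q.1
  · simp [planKernel, h, logKernel_self]
  · obtain ⟨h1, h2⟩ := toENNReal_logKernel_of_ne h
    have h3 := (log_le_quad (norm_pos_iff.2 (sub_ne_zero.2 h))).trans (norm_fst_sub_fst_sq_le p q)
    have hp := quad_nonneg p
    have hq := quad_nonneg q
    rw [h1, h2, planKernel, if_neg h, ← ENNReal.ofReal_add hp hq]
    rcases le_total 0 (Real.log ‖p.1 - q.1‖) with h0 | h0
    · rw [← ENNReal.ofReal_add (by linarith) h0,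
        ENNReal.ofReal_of_nonpos (neg_nonpos.2 h0), zero_add]
      congr 1; ring
    · rw [ENNReal.ofReal_of_nonpos h0, add_zero, ← ENNReal.ofReal_add (by linarith) (by linarith)]
      congr 1; ring

theorem IsTransportPlan.isProbabilityMeasure {μ ν : Measure Plane} {γ : Measure (Plane × Plane)}
    [IsProbabilityMeasure ν] (h : IsTransportPlan μ ν γ) : IsProbabilityMeasure γ := by
  constructor
  rw [← preimage_univ (f := (Prod.snd : Plane × Plane → Plane)),
    ← Measure.map_apply measurable_snd MeasurableSet.univ, h.2, measure_univ]

theorem lintegral_quad {μ ν : Measure Plane} {γ : Measure (Plane × Plane)}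
    [IsProbabilityMeasure ν] (h : IsTransportPlan μ ν γ) :
    2 * ∫⁻ p, ENNReal.ofReal (quad p) ∂γ =
      2⁻¹ * ∫⁻ p, edist p.1 p.2 ^ 2 ∂γ + targetMoment ν := by
  have := h.isProbabilityMeasure
  have h1 : ∀ p : Plane × Plane, 2 * ENNReal.ofReal (quad p) =
      2⁻¹ * edist p.1 p.2 ^ 2 + (2⁻¹ * ‖p.2‖ₑ ^ 2 + 2) := fun p ↦ by
    have h2 : ∀ a b : ℝ, 0 ≤ a → 0 ≤ b → 2 * ENNReal.ofReal (a ^ 2 / 4 + b ^ 2 / 4 + 1) =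
        2⁻¹ * ENNReal.ofReal a ^ 2 + (2⁻¹ * ENNReal.ofReal b ^ 2 + 2) := fun a b ha hb ↦ by
      rw [← ENNReal.ofReal_pow ha, ← ENNReal.ofReal_pow hb, ← ENNReal.ofReal_ofNat 2,
        ← ENNReal.ofReal_inv_of_pos two_pos, ← ENNReal.ofReal_mul two_pos.le,
        ← ENNReal.ofReal_mul (by positivity), ← ENNReal.ofReal_mul (by positivity),
        ← ENNReal.ofReal_add (by positivity) (by positivity),
        ← ENNReal.ofReal_add (by positivity) (by positivity)]
      congr 1; ring
    rw [edist_eq_enorm_sub, ← ofReal_norm, ← ofReal_norm]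
    exact h2 _ _ (norm_nonneg _) (norm_nonneg _)
  have h2 : ∫⁻ p, ‖p.2‖ₑ ^ 2 ∂γ = ∫⁻ y, ‖y‖ₑ ^ 2 ∂ν := by
    rw [← h.2, lintegral_map (by fun_prop) measurable_snd]
  rw [← lintegral_const_mul _ (by fun_prop)]
  simp_rw [h1]
  rw [lintegral_add_left (by fun_prop), lintegral_const_mul _ (by fun_prop),
    lintegral_add_right _ measurable_const, lintegral_const_mul _ (by fun_prop), h2, targetMoment]
  simp

theorem lintegral_prod_fst {μ : Measure Plane} {γ : Measure (Plane × Plane)} [SFinite γ]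
    (h : γ.map Prod.fst = μ) {f : Plane × Plane → ℝ≥0∞} (hf : Measurable f) :
    ∫⁻ p, f p ∂(μ.prod μ) = ∫⁻ z, f (z.1.1, z.2.1) ∂(γ.prod γ) := by
  rw [← h, Measure.map_prod_map _ _ measurable_fst measurable_fst,
    lintegral_map hf (measurable_fst.prodMap measurable_fst)]
  rfl

theorem lintegral_prod_add_eq {Z : Type*} [MeasurableSpace Z] {γ : Measure Z}
    [IsProbabilityMeasure γ] {k l n : Z × Z → ℝ≥0∞} {a : Z → ℝ≥0∞} (hk : Measurable k)
    (hl : Measurable l) (ha : Measurable a)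
    (h : ∀ z, k z + n z = l z + (a z.1 + a z.2)) :
    ∫⁻ z, k z ∂(γ.prod γ) + ∫⁻ z, n z ∂(γ.prod γ) =
      ∫⁻ z, l z ∂(γ.prod γ) + 2 * ∫⁻ p, a p ∂γ := by
  rw [← lintegral_add_left hk, lintegral_congr h, lintegral_add_left hl,
    lintegral_add_left (by fun_prop), measurePreserving_fst.lintegral_comp ha,
    measurePreserving_snd.lintegral_comp ha, two_mul]

theorem energy_add_logEnergyNeg {μ ν : Measure Plane} {γ : Measure (Plane × Plane)}
    [IsProbabilityMeasure ν] (h : IsTransportPlan μ ν γ) :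
    energy γ γ + logEnergyNeg μ =
      logEnergyPos μ + 2⁻¹ * ∫⁻ p, edist p.1 p.2 ^ 2 ∂γ + targetMoment ν := by
  have := h.isProbabilityMeasure
  have hk : Measurable fun p : Plane × Plane ↦ (logKernel p.1 p.2).toENNReal :=
    measurable_logKernel.ereal_toENNReal
  have hk' : Measurable fun p : Plane × Plane ↦ (-logKernel p.1 p.2).toENNReal :=
    measurable_logKernel.neg.ereal_toENNReal
  have hm : Measurable fun z : (Plane × Plane) × (Plane × Plane) ↦ (z.1.1, z.2.1) := by fun_prop
  rw [add_assoc, ← lintegral_quad h, energy_eq_lintegral_prod, logEnergyNeg, logEnergyPos,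
    lintegral_prod_fst h.1 hk, lintegral_prod_fst h.1 hk']
  exact lintegral_prod_add_eq measurable_planKernel
    (by simpa only [Function.comp_def] using hk.comp hm) (by fun_prop)
    fun z ↦ planKernel_add_logKernel z.1 z.2

theorem minEnergy_add_logEnergyNeg (ρ₀ μ : Measure Plane) [IsProbabilityMeasure ρ₀] :
    minEnergy ρ₀ μ + logEnergyNeg μ =
      logEnergyPos μ + wassersteinSq μ ρ₀ + targetMoment ρ₀ := by
  simp only [minEnergy, wassersteinSq, ENNReal.iInf_add, ENNReal.add_iInf]
  exact iInf_congr fun γ ↦ iInf_congr fun h ↦ energy_add_logEnergyNeg h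

theorem logEnergyNeg_lt_top {μ : Measure Plane} (hμ : μ ∈ P2) : logEnergyNeg μ < ∞ := by
  obtain ⟨_, h2⟩ := hμ
  have h : ∀ p : Plane × Plane, (-logKernel p.1 p.2).toENNReal ≤ ‖p.1‖ₑ ^ 2 + ‖p.2‖ₑ ^ 2 + 1 := by
    intro p
    by_cases hp : p.1 = p.2
    · simp [hp, logKernel_self]
    rw [(toENNReal_logKernel_of_ne hp).2, ← ofReal_norm, ← ofReal_norm,
      ← ENNReal.ofReal_pow (norm_nonneg _), ← ENNReal.ofReal_pow (norm_nonneg _),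
      ← ENNReal.ofReal_one, ← ENNReal.ofReal_add (by positivity) (by positivity),
      ← ENNReal.ofReal_add (by positivity) (by positivity)]
    gcongr
    refine (log_le_quad (norm_pos_iff.2 (sub_ne_zero.2 hp))).trans ?_
    nlinarith [norm_sub_le p.1 p.2, norm_nonneg (p.1 - p.2), sq_nonneg (‖p.1‖ - ‖p.2‖),
      norm_nonneg p.1, norm_nonneg p.2]
  refine (lintegral_mono h).trans_lt ?_
  rw [lintegral_add_right _ measurable_const, lintegral_add_left (by fun_prop),
    lintegral_prod _ (by fun_prop), lintegral_prod _ (by fun_prop)]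
  simp [h2]

theorem J_eq {ρ₀ μ : Measure Plane} [IsProbabilityMeasure ρ₀] (hμ : μ ∈ P2)
    (h₀ : targetMoment ρ₀ < ∞) : J ρ₀ μ = (minEnergy ρ₀ μ : EReal) - (targetMoment ρ₀ : EReal) := by
  have h := minEnergy_add_logEnergyNeg ρ₀ μ
  have hN := logEnergyNeg_lt_top hμ
  change ((logEnergyPos μ : EReal) - (logEnergyNeg μ : EReal)) + (wassersteinSq μ ρ₀ : EReal) = _
  generalize logEnergyPos μ = P at *
  generalize logEnergyNeg μ = N at *
  generalize wassersteinSq μ ρ₀ = W at *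
  generalize minEnergy ρ₀ μ = E at *
  generalize targetMoment ρ₀ = c at *
  lift N to NNReal using hN.ne
  lift c to NNReal using h₀.ne
  by_cases hE : E = ∞
  · subst hE
    have : P = ∞ ∨ W = ∞ := by simpa using h.symm
    rcases this with rfl | rfl
    · simp [EReal.top_add_of_ne_bot]
    · rw [EReal.coe_ennreal_top, EReal.add_top_of_ne_bot]
      · simp
      · rw [sub_eq_add_neg]
        exact EReal.add_ne_bot_iff.2 ⟨by simp, by simp⟩
  · have : P ≠ ∞ ∧ W ≠ ∞ := by
      have h1 : P + W + c ≠ ∞ := by rw [← h]; simp [hE]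
      simpa using h1
    lift P to NNReal using this.1
    lift W to NNReal using this.2
    lift E to NNReal using hE
    have h1 : (E : ℝ) + N = P + W + c := by exact_mod_cast h
    have h2 : ∀ a : NNReal, (((a : ℝ≥0∞)) : EReal) = ((a : ℝ) : EReal) := fun a ↦ rfl
    simp only [h2]
    norm_cast
    linarith

theorem isMinimizer_iff {ρ₀ ρ : Measure Plane} [IsProbabilityMeasure ρ₀]
    (h₀ : targetMoment ρ₀ < ∞) :
    IsMinimizer ρ₀ ρ ↔ ρ ∈ P2 ∧ ∀ μ ∈ P2, minEnergy ρ₀ ρ ≤ minEnergy ρ₀ μ := by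
  refine and_congr_right fun hρ ↦ forall₂_congr fun μ hμ ↦ ?_
  rw [J_eq hρ h₀, J_eq hμ h₀]
  lift targetMoment ρ₀ to NNReal using h₀.ne with c
  constructor
  · intro h
    by_contra h'
    refine (EReal.sub_lt_sub_of_lt_of_le (z := ((c : ℝ≥0∞) : EReal)) (t := ((c : ℝ≥0∞) : EReal))
      (EReal.coe_ennreal_lt_coe_ennreal_iff.2 (not_le.1 h')) le_rfl ?_ ?_).not_ge h
    · simp
    · simp
  · intro h
    exact EReal.sub_le_sub (by exact_mod_cast h) le_rfl

theorem mem_P2_of_energy_lt_top {γ : Measure (Plane × Plane)} [IsProbabilityMeasure γ]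
    (h : energy γ γ < ∞) : γ.map Prod.fst ∈ P2 := by
  refine ⟨Measure.isProbabilityMeasure_map (by fun_prop), ?_⟩
  rw [lintegral_map (by fun_prop) measurable_fst]
  have h1 : ∀ p : Plane × Plane, ‖p.1‖ₑ ^ 2 ≤ 8 * ENNReal.ofReal (quad p) := fun p ↦ by
    rw [← ofReal_norm, ← ENNReal.ofReal_pow (norm_nonneg _), ← ENNReal.ofReal_ofNat 8,
      ← ENNReal.ofReal_mul (by norm_num)]
    gcongr
    exact norm_sq_le_quad p
  refine (lintegral_mono h1).trans_lt ?_
  rw [lintegral_const_mul _ (by fun_prop)]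
  exact ENNReal.mul_lt_top (by simp) (lintegral_quad_lt_top h)

/-! ### First variation and circular competitors. -/

/-- The derivative at `t = 0` along the segment from γ to σ is nonnegative. Finite energy of σ
controls the term in `t ^ 2`; no convexity of the energy is needed. -/
theorem energy_le_of_forall_convex {γ σ : Measure (Plane × Plane)} [IsProbabilityMeasure γ]
    [IsProbabilityMeasure σ] (hγ : energy γ γ < ∞) (hσ : energy σ σ < ∞)
    (h : ∀ t : ℝ, 0 < t → t < 1 → energy γ γ ≤
      energy (ENNReal.ofReal (1 - t) • γ + ENNReal.ofReal t • σ)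
        (ENNReal.ofReal (1 - t) • γ + ENNReal.ofReal t • σ)) :
    energy γ γ ≤ energy σ γ := by
  by_contra! hlt
  have hb : energy σ γ ≠ ∞ := (hlt.trans hγ).ne
  simp only [energy_add_left, energy_add_right, energy_smul_left, energy_smul_right,
    energy_comm γ σ] at h
  lift energy γ γ to NNReal using hγ.ne with e
  lift energy σ σ to NNReal using hσ.ne with s
  lift energy σ γ to NNReal using hb with b
  have hlt' : (b : ℝ) < e := by exact_mod_cast hlt
  have hb0 := b.coe_nonneg
  have he0 := e.coe_nonneg
  have hs0 := s.coe_nonneg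
  have hd : (0 : ℝ) < e + s + 1 := by positivity
  -- Minimality gives `2 * (e - b) ≤ t * (e - 2 * b + s)`, while this `t` makes the right side at
  -- most `e - b`.
  obtain ⟨t, ht⟩ : ∃ t : ℝ, t = (e - b) / (e + s + 1) := ⟨_, rfl⟩
  have ht0 : 0 < t := by rw [ht]; exact div_pos (by linarith) hd
  have ht1 : t < 1 := by rw [ht, div_lt_one hd]; linarith
  have hte : t * (e + s + 1) = e - b := by rw [ht]; field_simp
  have h1 := h t ht0 ht1
  have h2 : (e : ℝ) ≤ (1 - t) * ((1 - t) * e) + t * ((1 - t) * b) +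
      ((1 - t) * (t * b) + t * (t * s)) := by
    have h3 : 0 ≤ 1 - t := by linarith
    have hc : ∀ a : NNReal, (a : ℝ≥0∞) = ENNReal.ofReal a := fun a ↦ by simp
    simp only [hc] at h1
    rw [← ENNReal.ofReal_le_ofReal_iff (by positivity), ENNReal.ofReal_add (by positivity)
      (by positivity), ENNReal.ofReal_add (by positivity) (by positivity), ENNReal.ofReal_add
      (by positivity) (by positivity)]
    simp only [ENNReal.ofReal_mul h3, ENNReal.ofReal_mul ht0.le]
    refine h1.trans (le_of_eq ?_)
    ring
  have h3 : t * (2 * (e - b)) ≤ t * (t * (e - 2 * b + s)) := by linarith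
  have h4 := le_of_mul_le_mul_left h3 ht0
  nlinarith [mul_nonneg ht0.le hb0]

/-- The plan which transports the uniform measure on a circle independently to `ν`. -/
def circlePlan (z : Plane) (r : ℝ) (ν : Measure Plane) : Measure (Plane × Plane) :=
  (circleMeasure z r).prod ν

instance (z : Plane) (r : ℝ) (ν : Measure Plane) [IsFiniteMeasure ν] :
    IsFiniteMeasure (circlePlan z r ν) := by
  unfold circlePlan; infer_instance

theorem map_snd_circlePlan (z : Plane) (r : ℝ) (ν : Measure Plane) [IsFiniteMeasure ν] :
    (circlePlan z r ν).map Prod.snd = ν := by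
  simp [circlePlan]

theorem lintegral_circlePlan (z : Plane) (r : ℝ) (ν : Measure Plane) [IsFiniteMeasure ν]
    {f : Plane × Plane → ℝ≥0∞} (hf : Measurable f) :
    ∫⁻ p, f p ∂(circlePlan z r ν) = ∫⁻ y, ∫⁻ θ, f (circlePoint z r θ, y) ∂angleMeasure ∂ν := by
  rw [circlePlan, lintegral_prod_symm' _ hf]
  refine lintegral_congr fun y ↦ ?_
  rw [lintegral_circleMeasure (by fun_prop)]

theorem lintegral_quad_const_lt_top {ν : Measure Plane} [IsFiniteMeasure ν]
    (hν : ∫⁻ y, ‖y‖ₑ ^ 2 ∂ν < ∞) (z : Plane) : ∫⁻ y, ENNReal.ofReal (quad (z, y)) ∂ν < ∞ := by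
  have h : ∀ y, ENNReal.ofReal (quad (z, y)) ≤ ENNReal.ofReal (‖z‖ ^ 2 + 1) + ‖y‖ₑ ^ 2 := by
    intro y
    rw [← ofReal_norm y, ← ENNReal.ofReal_pow (norm_nonneg _),
      ← ENNReal.ofReal_add (by positivity) (by positivity)]
    gcongr
    simp only [quad]
    nlinarith [norm_sub_le z y, norm_nonneg (z - y), sq_nonneg (‖z‖ - ‖y‖), norm_nonneg z,
      norm_nonneg y]
  refine (lintegral_mono h).trans_lt ?_
  rw [lintegral_add_left measurable_const, lintegral_const]
  exact ENNReal.add_lt_top.2 ⟨ENNReal.mul_lt_top (by simp) (measure_lt_top _ _), hν⟩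

theorem lintegral_quad_circlePlan_lt_top {ν : Measure Plane} [IsFiniteMeasure ν]
    (hν : ∫⁻ y, ‖y‖ₑ ^ 2 ∂ν < ∞) (z : Plane) (r : ℝ) :
    ∫⁻ p, ENNReal.ofReal (quad p) ∂(circlePlan z r ν) < ∞ := by
  have h : ∀ y θ, ENNReal.ofReal (quad (circlePoint z r θ, y)) ≤
      2 * ENNReal.ofReal (quad (z, y)) + ENNReal.ofReal (r ^ 2) := by
    intro y θ
    rw [← ENNReal.ofReal_ofNat 2, ← ENNReal.ofReal_mul (by norm_num),
      ← ENNReal.ofReal_add (mul_nonneg (by norm_num) (quad_nonneg _)) (by positivity)]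
    gcongr
    have h1 : ‖circlePoint z r θ - y‖ ≤ |r| + ‖z - y‖ := by
      rw [← norm_circlePoint_sub_self z r θ]
      exact norm_sub_le_norm_sub_add_norm_sub _ _ _
    have h2 := sq_abs r
    simp only [quad]
    nlinarith [norm_nonneg (z - y), sq_nonneg (|r| - ‖z - y‖), abs_nonneg r, sq_nonneg ‖y‖,
      norm_nonneg (circlePoint z r θ - y)]
  rw [lintegral_circlePlan z r ν (by fun_prop)]
  refine (lintegral_mono fun y ↦ lintegral_mono (h y)).trans_lt ?_
  simp only [lintegral_const, measure_univ, mul_one]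
  rw [lintegral_add_right _ measurable_const, lintegral_const_mul _ (by fun_prop), lintegral_const]
  exact ENNReal.add_lt_top.2 ⟨ENNReal.mul_lt_top (by simp) (lintegral_quad_const_lt_top hν z),
    ENNReal.mul_lt_top (by simp) (measure_lt_top _ _)⟩

theorem energy_circlePlan_left (z : Plane) (r : ℝ) (ν : Measure Plane) [IsFiniteMeasure ν]
    (τ : Measure (Plane × Plane)) [SFinite τ] :
    energy (circlePlan z r ν) τ =
      ∫⁻ y, ∫⁻ θ, potential τ (circlePoint z r θ, y) ∂angleMeasure ∂ν :=
  lintegral_circlePlan z r ν (measurable_potential τ)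

/-- Averaging over the circle cuts the singularity off at `r`, so second moments suffice and `τ` may
have infinite energy. -/
theorem energy_circlePlan_lt_top {ν : Measure Plane} [IsFiniteMeasure ν]
    (hν : ∫⁻ y, ‖y‖ₑ ^ 2 ∂ν < ∞) (z : Plane) {r : ℝ} (hr : 0 < r) {τ : Measure (Plane × Plane)}
    [IsFiniteMeasure τ] (hτ : ∫⁻ p, ENNReal.ofReal (quad p) ∂τ < ∞) :
    energy (circlePlan z r ν) τ < ∞ := by
  rw [energy_circlePlan_left]
  simp_rw [lintegral_potential_circlePoint τ z _ hr]
  have h : ∀ y q, ENNReal.ofReal (kernelTrunc r (z, y) q + r ^ 2 / 4) ≤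
      ENNReal.ofReal (quad (z, y)) + (ENNReal.ofReal (quad q) +
        ENNReal.ofReal (-Real.log r + r ^ 2 / 4)) := by
    intro y q
    refine le_trans ?_ (add_le_add_right ENNReal.ofReal_add_le _)
    refine le_trans (ENNReal.ofReal_le_ofReal ?_) ENNReal.ofReal_add_le
    have : Real.log r ≤ Real.log (max ‖z - q.1‖ r) := Real.log_le_log hr (le_max_right _ _)
    simp only [kernelTrunc]
    linarith
  refine (lintegral_mono fun y ↦ lintegral_mono (h y)).trans_lt ?_
  simp_rw [lintegral_add_left measurable_const, lintegral_add_right _ measurable_const,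
    lintegral_const]
  rw [lintegral_mul_const _ (by fun_prop)]
  refine ENNReal.add_lt_top.2 ⟨ENNReal.mul_lt_top (lintegral_quad_const_lt_top hν z)
    (measure_lt_top _ _), ENNReal.add_lt_top.2 ⟨ENNReal.mul_lt_top hτ (measure_lt_top _ _), ?_⟩⟩
  exact ENNReal.mul_lt_top (ENNReal.mul_lt_top (by simp) (measure_lt_top _ _))
    (measure_lt_top _ _)

/-- `γ` has finite energy, and it minimizes the energy among the plans with second marginal
`ρ₀`. -/
structure IsOptimalPlan (ρ₀ : Measure Plane) (γ : Measure (Plane × Plane)) : Prop where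
  isProbabilityMeasure : IsProbabilityMeasure γ
  map_snd : γ.map Prod.snd = ρ₀
  energy_lt_top : energy γ γ < ∞
  energy_le : ∀ σ : Measure (Plane × Plane), σ.map Prod.snd = ρ₀ → energy γ γ ≤ energy σ σ

theorem IsOptimalPlan.ae_potential_le_circle {ρ₀ : Measure Plane} {γ : Measure (Plane × Plane)}
    (hγ : IsOptimalPlan ρ₀ γ) (h₀ : ∫⁻ y, ‖y‖ₑ ^ 2 ∂ρ₀ < ∞) (z : Plane) {r : ℝ} (hr : 0 < r) :
    ∀ᵐ p ∂γ, potential γ p ≤ ∫⁻ θ, potential γ (circlePoint z r θ, p.2) ∂angleMeasure := by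
  have := hγ.isProbabilityMeasure
  refine ae_le_of_forall_setLIntegral_le_of_sigmaFinite (measurable_potential γ) fun A hA _ ↦ ?_
  obtain ⟨ν, hν⟩ : ∃ ν, ν = (γ.restrict A).map Prod.snd := ⟨_, rfl⟩
  have hνfin : IsFiniteMeasure ν := by rw [hν]; infer_instance
  have hνle : ν ≤ ρ₀ := by
    rw [hν, ← hγ.map_snd]; exact Measure.map_mono Measure.restrict_le_self measurable_snd
  have hν2 : ∫⁻ y, ‖y‖ₑ ^ 2 ∂ν < ∞ := (lintegral_mono' hνle le_rfl).trans_lt h₀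
  -- The mass in `A` is moved onto the circle while its distribution of targets `ν` is kept, so the
  -- second marginal is unchanged.
  obtain ⟨σ, hσ⟩ : ∃ σ, σ = γ.restrict Aᶜ + circlePlan z r ν := ⟨_, rfl⟩
  have hσ2 : σ.map Prod.snd = ρ₀ := by
    rw [hσ, Measure.map_add _ _ measurable_snd, map_snd_circlePlan, hν,
      ← Measure.map_add _ _ measurable_snd, Measure.restrict_compl_add_restrict hA, hγ.map_snd]
  have hσp : IsProbabilityMeasure σ := by
    constructor
    rw [← preimage_univ (f := (Prod.snd : Plane × Plane → Plane)),
      ← Measure.map_apply measurable_snd MeasurableSet.univ, hσ2, ← hγ.map_snd,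
      Measure.map_apply measurable_snd MeasurableSet.univ, preimage_univ, measure_univ]
  have hr1 : energy (γ.restrict Aᶜ) (γ.restrict Aᶜ) < ∞ :=
    (energy_mono Measure.restrict_le_self Measure.restrict_le_self).trans_lt hγ.energy_lt_top
  have hr2 : energy (circlePlan z r ν) (γ.restrict Aᶜ) < ∞ :=
    energy_circlePlan_lt_top hν2 z hr ((lintegral_mono' Measure.restrict_le_self le_rfl).trans_lt
      (lintegral_quad_lt_top hγ.energy_lt_top))
  have hr3 : energy (circlePlan z r ν) (circlePlan z r ν) < ∞ :=
    energy_circlePlan_lt_top hν2 z hr (lintegral_quad_circlePlan_lt_top hν2 z r)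
  have hσe : energy σ σ < ∞ := by
    rw [hσ, energy_add_left, energy_add_right, energy_add_right,
      energy_comm (γ.restrict Aᶜ) (circlePlan z r ν)]
    exact ENNReal.add_lt_top.2 ⟨ENNReal.add_lt_top.2 ⟨hr1, hr2⟩, ENNReal.add_lt_top.2 ⟨hr2, hr3⟩⟩
  have key : energy γ γ ≤ energy σ γ := by
    refine energy_le_of_forall_convex hγ.energy_lt_top hσe fun t ht0 ht1 ↦ hγ.energy_le _ ?_
    rw [Measure.map_add _ _ measurable_snd, Measure.map_smul, Measure.map_smul, hγ.map_snd, hσ2,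
      ← add_smul, ← ENNReal.ofReal_add (by linarith) ht0.le]
    simp
  have h1 : energy γ γ = energy (γ.restrict Aᶜ) γ + ∫⁻ p in A, potential γ p ∂γ := by
    rw [add_comm]; exact (lintegral_add_compl _ hA).symm
  have hm : Measurable fun y ↦ ∫⁻ θ, potential γ (circlePoint z r θ, y) ∂angleMeasure := by
    have hc : Measurable fun a : Plane × ℝ ↦ (circlePoint z r a.2, a.1) :=
      Continuous.measurable (by fun_prop)
    exact ((measurable_potential γ).comp hc).lintegral_prod_right'
  have h2 : energy (circlePlan z r ν) γ =
      ∫⁻ p in A, ∫⁻ θ, potential γ (circlePoint z r θ, p.2) ∂angleMeasure ∂γ := by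
    rw [energy_circlePlan_left, hν, lintegral_map hm measurable_snd]
  rw [hσ, energy_add_left, h1, h2] at key
  refine (ENNReal.add_le_add_iff_left ?_).1 key
  exact ((energy_mono Measure.restrict_le_self le_rfl).trans_lt hγ.energy_lt_top).ne

/-! ### From circle averages to pointwise minimality. -/

theorem kernelTrunc_le_add {ε : ℝ} (hε : 0 < ε) (z z' y : Plane) (q : Plane × Plane) :
    kernelTrunc ε (z', y) q ≤
      kernelTrunc ε (z, y) q + (‖z - z'‖ / ε + quad (z', y) - quad (z, y)) := by
  have hu : 0 < max ‖z - q.1‖ ε := lt_max_of_lt_right hε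
  have hv : 0 < max ‖z' - q.1‖ ε := lt_max_of_lt_right hε
  have h1 : max ‖z - q.1‖ ε ≤ max ‖z' - q.1‖ ε + ‖z - z'‖ := by
    refine max_le ?_ ?_
    · have := norm_sub_le_norm_sub_add_norm_sub z z' q.1
      linarith [le_max_left ‖z' - q.1‖ ε]
    · linarith [le_max_right ‖z' - q.1‖ ε, norm_nonneg (z - z')]
  have h2 := Real.log_le_sub_one_of_pos (div_pos hu hv)
  rw [Real.log_div hu.ne' hv.ne'] at h2
  have h3 : max ‖z - q.1‖ ε / max ‖z' - q.1‖ ε - 1 ≤ ‖z - z'‖ / ε := by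
    calc _ = (max ‖z - q.1‖ ε - max ‖z' - q.1‖ ε) / max ‖z' - q.1‖ ε := by field_simp
      _ ≤ ‖z - z'‖ / max ‖z' - q.1‖ ε := by gcongr; linarith
      _ ≤ ‖z - z'‖ / ε := by gcongr; exact le_max_right _ _
  simp only [kernelTrunc]
  linarith

theorem lintegral_potential_circlePoint_le_of_center (γ : Measure (Plane × Plane))
    [IsProbabilityMeasure γ] (z z' y : Plane) {r : ℝ} (hr : 0 < r) :
    ∫⁻ θ, potential γ (circlePoint z' r θ, y) ∂angleMeasure ≤ potential γ (z, y) +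
      ENNReal.ofReal (‖z - z'‖ / r + quad (z', y) - quad (z, y) + r ^ 2 / 4) := by
  rw [lintegral_potential_circlePoint γ z' y hr]
  have h : ∀ q, ENNReal.ofReal (kernelTrunc r (z', y) q + r ^ 2 / 4) ≤ planKernel (z, y) q +
      ENNReal.ofReal (‖z - z'‖ / r + quad (z', y) - quad (z, y) + r ^ 2 / 4) := fun q ↦ by
    refine le_trans ?_ (add_le_add_left (ofReal_kernelTrunc_le r (z, y) q) _)
    refine le_trans (ENNReal.ofReal_le_ofReal ?_) ENNReal.ofReal_add_le
    linarith [kernelTrunc_le_add hr z z' y q]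
  refine (lintegral_mono h).trans (le_of_eq ?_)
  rw [lintegral_add_right _ measurable_const]
  simp [potential]

theorem IsOptimalPlan.ae_potential_le {ρ₀ : Measure Plane} {γ : Measure (Plane × Plane)}
    (hγ : IsOptimalPlan ρ₀ γ) (h₀ : ∫⁻ y, ‖y‖ₑ ^ 2 ∂ρ₀ < ∞) :
    ∀ᵐ p ∂γ, ∀ z, potential γ p ≤ potential γ (z, p.2) := by
  have := hγ.isProbabilityMeasure
  -- Countably many centres and radii, so that one null set serves all of them.
  have h : ∀ᵐ p ∂γ, ∀ n m : ℕ, potential γ p ≤ ∫⁻ θ, potential γ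
      (circlePoint (TopologicalSpace.denseSeq Plane n) (1 / ((m : ℝ) + 1)) θ, p.2)
        ∂angleMeasure :=
    ae_all_iff.2 fun n ↦ ae_all_iff.2 fun m ↦
      hγ.ae_potential_le_circle h₀ _ Nat.one_div_pos_of_nat
  filter_upwards [h] with p hp z
  have h1 : ∀ m : ℕ, potential γ p ≤
      potential γ (z, p.2) + ENNReal.ofReal ((1 / ((m : ℝ) + 1)) ^ 2 / 4) := fun m ↦ by
    -- At fixed radius the bound is continuous in the centre `z'`, although the potential itself
    -- need not be. It therefore extends from dense centres to all, and `z' = z` removes the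
    -- Lipschitz error.
    have h2 : ∀ z', potential γ p ≤ potential γ (z, p.2) + ENNReal.ofReal
        (‖z - z'‖ / (1 / ((m : ℝ) + 1)) + quad (z', p.2) - quad (z, p.2) +
          (1 / ((m : ℝ) + 1)) ^ 2 / 4) := fun z' ↦ by
      refine (TopologicalSpace.denseRange_denseSeq Plane).induction_on z' ?_ fun n ↦
        (hp n m).trans (lintegral_potential_circlePoint_le_of_center γ z _ p.2
          Nat.one_div_pos_of_nat)
      exact isClosed_le continuous_const (continuous_const.add
        (ENNReal.continuous_ofReal.comp (by fun_prop)))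
    simpa using h2 z
  have h3 : Tendsto (fun m : ℕ ↦
      potential γ (z, p.2) + ENNReal.ofReal ((1 / ((m : ℝ) + 1)) ^ 2 / 4)) atTop
      (𝓝 (potential γ (z, p.2) + ENNReal.ofReal (0 ^ 2 / 4))) :=
    tendsto_const_nhds.add (ENNReal.tendsto_ofReal
      ((tendsto_one_div_add_atTop_nhds_zero_nat.pow 2).div_const 4))
  simpa using ge_of_tendsto' h3 h1

/-! ### Uniqueness of the target. -/

theorem potential_add_quad (γ : Measure (Plane × Plane)) [IsProbabilityMeasure γ]
    (x y y' : Plane) :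
    potential γ (x, y) + ENNReal.ofReal (quad (x, y')) =
      potential γ (x, y') + ENNReal.ofReal (quad (x, y)) := by
  have h := lintegral_congr (μ := γ) fun q ↦ planKernel_add_quad x y y' q
  rw [lintegral_add_right _ measurable_const, lintegral_add_right _ measurable_const] at h
  simpa [potential] using h

theorem quad_sub_quad (x x' y y' : Plane) :
    quad (x, y') - quad (x, y) + quad (x', y) - quad (x', y') =
      inner ℝ (x' - x) (y' - y) / 2 := by
  simp only [quad, norm_sub_sq_real, inner_sub_left, inner_sub_right]
  ring

/-- Minimality for `y` gives the bound with 0. Minimality for `y'`, carried over to `y` by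
`potential_add_quad`, gives it with the inner product; the maximum is the kink. -/
theorem add_inner_le_potential {γ : Measure (Plane × Plane)} [IsProbabilityMeasure γ]
    {x y y' : Plane} (hfin : potential γ (x, y) ≠ ∞)
    (h : ∀ z, potential γ (x, y) ≤ potential γ (z, y))
    (h' : ∀ z, potential γ (x, y') ≤ potential γ (z, y')) (x' : Plane) :
    ENNReal.ofReal ((potential γ (x, y)).toReal + max 0 (inner ℝ (x' - x) (y' - y)) / 2) ≤
      potential γ (x', y) := by
  by_cases htop : potential γ (x', y) = ∞
  · simp [htop]
  have e1 := potential_add_quad γ x y y'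
  have e2 := potential_add_quad γ x' y y'
  have hle := h x'
  have hle' := h' x'
  have f1 : potential γ (x, y') ≠ ∞ := by
    intro h; rw [h] at e1; simp [hfin] at e1
  have f2 : potential γ (x', y') ≠ ∞ := by
    intro h; rw [h] at e2; simp [htop] at e2
  have hq := quad_sub_quad x x' y y'
  have r1 := congrArg ENNReal.toReal e1
  have r2 := congrArg ENNReal.toReal e2
  rw [ENNReal.toReal_add hfin (by simp), ENNReal.toReal_add f1 (by simp),
    ENNReal.toReal_ofReal (quad_nonneg _), ENNReal.toReal_ofReal (quad_nonneg _)] at r1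
  rw [ENNReal.toReal_add htop (by simp), ENNReal.toReal_add f2 (by simp),
    ENNReal.toReal_ofReal (quad_nonneg _), ENNReal.toReal_ofReal (quad_nonneg _)] at r2
  have r3 := ENNReal.toReal_mono htop hle
  have r4 := ENNReal.toReal_mono f2 hle'
  rw [ENNReal.ofReal_le_iff_le_toReal htop]
  rcases le_total 0 (inner ℝ (x' - x) (y' - y) : ℝ) with h0 | h0
  · rw [max_eq_right h0]; linarith
  · rw [max_eq_left h0]; linarith

theorem eq_of_forall_potential_le {γ : Measure (Plane × Plane)} [IsProbabilityMeasure γ]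
    {x y y' : Plane} (hfin : potential γ (x, y) ≠ ∞)
    (h : ∀ z, potential γ (x, y) ≤ potential γ (z, y))
    (h' : ∀ z, potential γ (x, y') ≤ potential γ (z, y')) : y = y' := by
  by_contra hne
  obtain ⟨w, hw⟩ : ∃ w, w = y' - y := ⟨_, rfl⟩
  have hw0 : 0 < ‖w‖ := norm_pos_iff.2 (by rw [hw]; exact sub_ne_zero.2 (Ne.symm hne))
  -- The kink yields a gain of at least `r * ‖w‖ / 8`, against the permitted `r ^ 2 / 4`; any `r <
  -- ‖w‖ / 2` is contradictory.
  obtain ⟨r, hr⟩ : ∃ r, r = ‖w‖ / 4 := ⟨_, rfl⟩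
  have hr0 : 0 < r := by rw [hr]; positivity
  set v := (potential γ (x, y)).toReal with hv
  have hv0 : 0 ≤ v := ENNReal.toReal_nonneg
  let s : ℝ → ℝ := fun θ ↦ inner ℝ (circlePoint x r θ - x) w
  have hs : Continuous s := by fun_prop
  have hint : ∀ {f : ℝ → ℝ}, Continuous f → Integrable f angleMeasure := fun hf ↦
    integrable_angleMeasure (hf.intervalIntegrable _ _)
  -- The positive part is `(s + |s|) / 2`, and `|s|` dominates `s ^ 2 / (r * ‖w‖)`; only the first
  -- two moments of `s` are then needed.
  have hmax : ∀ θ, (s θ + s θ ^ 2 / (r * ‖w‖)) / 2 ≤ max 0 (s θ) := by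
    intro θ
    have h1 : |s θ| ≤ r * ‖w‖ := by
      refine (abs_real_inner_le_norm _ _).trans ?_
      rw [norm_circlePoint_sub_self, abs_of_pos hr0]
    have h2 : s θ ^ 2 / (r * ‖w‖) ≤ |s θ| := by
      rw [div_le_iff₀ (by positivity), ← sq_abs]
      nlinarith [abs_nonneg (s θ)]
    rcases le_total 0 (s θ) with h0 | h0
    · rw [max_eq_right h0]; rw [abs_of_nonneg h0] at h2; linarith
    · rw [max_eq_left h0]; rw [abs_of_nonpos h0] at h2; linarith
  have h1 : v + r * ‖w‖ / 8 ≤ ∫ θ, (v + max 0 (s θ) / 2) ∂angleMeasure := by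
    have h2 : ∫ θ, (v + (s θ / 4 + s θ ^ 2 / (r * ‖w‖ * 4))) ∂angleMeasure =
        v + r * ‖w‖ / 8 := by
      rw [integral_add (integrable_const _) (hint (by fun_prop)), integral_add (hint (by fun_prop))
        (hint (by fun_prop)), integral_div, integral_div, integral_inner_circlePoint,
        integral_inner_sq_circlePoint]
      simp
      field_simp
      norm_num
    rw [← h2]
    refine integral_mono (hint (by fun_prop)) (hint (by fun_prop)) fun θ ↦ ?_
    have h3 := hmax θ
    have h4 : s θ ^ 2 / (r * ‖w‖ * 4) = s θ ^ 2 / (r * ‖w‖) / 4 := by rw [div_div]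
    simp only [h4]
    linarith
  have h2 : ENNReal.ofReal (v + r * ‖w‖ / 8) ≤
      ∫⁻ θ, potential γ (circlePoint x r θ, y) ∂angleMeasure := by
    refine (ENNReal.ofReal_le_ofReal h1).trans ?_
    rw [ofReal_integral_eq_lintegral_ofReal (hint (by fun_prop))
      (Eventually.of_forall fun θ ↦ add_nonneg hv0 (by positivity))]
    refine lintegral_mono fun θ ↦ ?_
    have h3 := add_inner_le_potential hfin h h' (circlePoint x r θ)
    rwa [← hw] at h3
  have h3 := h2.trans (lintegral_potential_circlePoint_le γ x y hr0)
  rw [← ENNReal.ofReal_toReal hfin, ← hv, ← ENNReal.ofReal_add hv0 (by positivity),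
    ENNReal.ofReal_le_ofReal_iff (by positivity)] at h3
  rw [hr] at h3
  nlinarith

/-- Lusin–Souslin: the first projection is injective on a Borel set of full measure, hence a
measurable embedding, and the second coordinate extends from its image. -/
theorem exists_measurable_graph {X Y : Type*} [MeasurableSpace X] [StandardBorelSpace X]
    [MeasurableSpace Y] [StandardBorelSpace Y] [Nonempty Y] {γ : Measure (X × Y)}
    {P : X × Y → Prop} (hP : ∀ᵐ p ∂γ, P p)
    (hinj : ∀ x y y', P (x, y) → P (x, y') → y = y') :
    ∃ T : X → Y, Measurable T ∧ ∀ᵐ p ∂γ, T p.1 = p.2 := by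
  obtain ⟨G, hG, hGm, hGP⟩ := hP.exists_measurable_mem
  have := hGm.standardBorel
  have hemb : MeasurableEmbedding fun p : G ↦ (p : X × Y).1 := by
    refine (measurable_fst.comp measurable_subtype_coe).measurableEmbedding ?_
    rintro ⟨⟨x, y⟩, hp⟩ ⟨⟨x', y'⟩, hp'⟩ h
    obtain rfl : x = x' := h
    obtain rfl := hinj x y y' (hGP _ hp) (hGP _ hp')
    rfl
  obtain ⟨T, hT, hTG⟩ := hemb.exists_measurable_extend
    (g := fun p : G ↦ (p : X × Y).2) (measurable_snd.comp measurable_subtype_coe)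
    fun _ ↦ inferInstance
  refine ⟨T, hT, ?_⟩
  filter_upwards [hG] with p hp
  exact congrFun hTG ⟨p, hp⟩

/-! ### Transport map, absence of atoms and compact support for optimal plans. -/

theorem IsOptimalPlan.ae_potential_lt_top {ρ₀ : Measure Plane} {γ : Measure (Plane × Plane)}
    (hγ : IsOptimalPlan ρ₀ γ) : ∀ᵐ p ∂γ, potential γ p < ∞ := by
  have := hγ.isProbabilityMeasure
  exact ae_lt_top (measurable_potential γ) hγ.energy_lt_top.ne

theorem IsOptimalPlan.exists_map {ρ₀ : Measure Plane} {γ : Measure (Plane × Plane)}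
    (hγ : IsOptimalPlan ρ₀ γ) (h₀ : ∫⁻ y, ‖y‖ₑ ^ 2 ∂ρ₀ < ∞) :
    ∃ T : Plane → Plane, Measurable T ∧ ∀ᵐ p ∂γ, T p.1 = p.2 := by
  have := hγ.isProbabilityMeasure
  exact exists_measurable_graph (hγ.ae_potential_lt_top.and (hγ.ae_potential_le h₀))
    fun x y y' h h' ↦ eq_of_forall_potential_le h.1.ne h.2 h'.2

theorem IsOptimalPlan.measure_singleton {ρ₀ : Measure Plane} {γ : Measure (Plane × Plane)}
    (hγ : IsOptimalPlan ρ₀ γ) (x : Plane) : γ.map Prod.fst {x} = 0 := by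
  have := hγ.isProbabilityMeasure
  rw [Measure.map_apply measurable_fst (measurableSet_singleton x)]
  by_contra h0
  -- An atom at `x` makes the potential infinite over `x`, by the diagonal value of the kernel.
  obtain ⟨p, hp, hfin⟩ := ((frequently_ae_mem_iff.2 h0).and_eventually
    hγ.ae_potential_lt_top).exists
  obtain rfl : p.1 = x := hp
  refine hfin.ne (lintegral_eq_top_of_measure_eq_top_ne_zero
    (measurable_planKernel.comp measurable_prodMk_left).aemeasurable fun h ↦ h0 ?_)
  refine measure_mono_null (fun q hq ↦ ?_) h
  have : p.1 = q.1 := (mem_singleton_iff.1 hq).symm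
  simp [planKernel, this]

theorem IsOptimalPlan.isCompact_support {ρ₀ : Measure Plane} {γ : Measure (Plane × Plane)}
    (hγ : IsOptimalPlan ρ₀ γ) {R : ℝ} (hR : ∀ᵐ y ∂ρ₀, ‖y‖ ≤ R) (h₀ : ∫⁻ y, ‖y‖ₑ ^ 2 ∂ρ₀ < ∞) :
    IsCompact (γ.map Prod.fst).support := by
  have := hγ.isProbabilityMeasure
  rw [← hγ.map_snd] at hR
  have hR' := ae_of_ae_map measurable_snd.aemeasurable hR
  -- Bound for the average over the unit circle about 0: the logarithm truncated at 1 is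
  -- nonnegative, `quad (0, y)` is at most `R ^ 2 / 2 + 1`, and the remaining 1 absorbs `r ^ 2 / 4`.
  obtain ⟨C, hC⟩ : ∃ C : ℝ≥0∞, C = ∫⁻ q, (ENNReal.ofReal (quad q) +
    ENNReal.ofReal (R ^ 2 / 2 + 2)) ∂γ := ⟨_, rfl⟩
  have hCfin : C ≠ ∞ := by
    rw [hC, lintegral_add_right _ measurable_const, lintegral_const]
    exact (ENNReal.add_lt_top.2 ⟨lintegral_quad_lt_top hγ.energy_lt_top, by simp⟩).ne
  have hb : ∀ᵐ p ∂γ, quad p / 2 ≤ C.toReal := by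
    filter_upwards [hR', hγ.ae_potential_le_circle h₀ 0 one_pos] with p hp hV
    rw [← ENNReal.ofReal_le_iff_le_toReal hCfin]
    calc ENNReal.ofReal (quad p / 2) = ∫⁻ _, ENNReal.ofReal (quad p / 2) ∂γ := by simp
      _ ≤ potential γ p := lintegral_mono fun q ↦ quad_le_planKernel p q
      _ ≤ _ := hV
      _ ≤ C := by
        rw [lintegral_potential_circlePoint γ 0 p.2 one_pos, hC]
        refine lintegral_mono fun q ↦ ?_
        refine le_trans (ENNReal.ofReal_le_ofReal ?_) ENNReal.ofReal_add_le
        have h1 : 0 ≤ Real.log (max ‖0 - q.1‖ 1) := Real.log_nonneg (le_max_right _ _)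
        have h2 : ‖p.2‖ ^ 2 ≤ R ^ 2 := by gcongr
        simp only [kernelTrunc]
        simp only [quad, zero_sub, norm_neg] at h1 ⊢
        linarith
  refine Metric.isCompact_of_isClosed_isBounded Measure.isClosed_support
    ((Metric.isBounded_closedBall (x := (0 : Plane)) (r := 16 * C.toReal)).subset
      (Measure.support_subset_of_isClosed Metric.isClosed_closedBall ?_))
  have hm : MeasurableSet {x : Plane | x ∈ Metric.closedBall 0 (16 * C.toReal)} :=
    Metric.isClosed_closedBall.measurableSet
  refine (ae_map_iff measurable_fst.aemeasurable hm).2 ?_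
  filter_upwards [hb] with p hp
  rw [mem_closedBall_zero_iff]
  nlinarith [norm_sq_le_quad p, one_le_quad p, norm_nonneg p.1]

/-! ### Optimal plans and minimizers of the functional. -/

theorem isTransportPlan_of_map_snd {ρ₀ : Measure Plane} {γ : Measure (Plane × Plane)}
    (h : γ.map Prod.snd = ρ₀) : IsTransportPlan (γ.map Prod.fst) ρ₀ γ := ⟨rfl, h⟩

theorem minEnergy_le {ρ₀ μ : Measure Plane} {γ : Measure (Plane × Plane)}
    (h : IsTransportPlan μ ρ₀ γ) : minEnergy ρ₀ μ ≤ energy γ γ := iInf₂_le γ h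

theorem exists_isOptimalPlan {ρ₀ : Measure Plane} [IsProbabilityMeasure ρ₀]
    (h₀ : ∫⁻ y, ‖y‖ₑ ^ 2 ∂ρ₀ < ∞) : ∃ γ, IsOptimalPlan ρ₀ γ := by
  have hσ : IsProbabilityMeasure (circlePlan 0 1 ρ₀) := by unfold circlePlan; infer_instance
  obtain ⟨γ, hγ, hmin⟩ := exists_energy_le_of_isClosed (isClosed_map_eq continuous_snd ρ₀)
    ⟨⟨circlePlan 0 1 ρ₀, hσ⟩, map_snd_circlePlan 0 1 ρ₀⟩
  refine ⟨γ, inferInstance, hγ, ?_, fun σ hσ ↦ ?_⟩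
  · have hlt : energy (circlePlan 0 1 ρ₀) (circlePlan 0 1 ρ₀) < ∞ :=
      energy_circlePlan_lt_top h₀ 0 one_pos (lintegral_quad_circlePlan_lt_top h₀ 0 1)
    exact (hmin ⟨circlePlan 0 1 ρ₀, hσ⟩ (map_snd_circlePlan 0 1 ρ₀)).trans_lt hlt
  · have := (isTransportPlan_of_map_snd hσ).isProbabilityMeasure
    exact hmin ⟨σ, this⟩ hσ

theorem exists_energy_eq_minEnergy (ρ₀ μ : Measure Plane) [IsProbabilityMeasure ρ₀]
    [IsProbabilityMeasure μ] : ∃ γ, IsTransportPlan μ ρ₀ γ ∧ energy γ γ = minEnergy ρ₀ μ := by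
  have h1 : (μ.prod ρ₀).map Prod.fst = μ := by simp
  have h2 : (μ.prod ρ₀).map Prod.snd = ρ₀ := by simp
  obtain ⟨γ, hγ, hmin⟩ := exists_energy_le_of_isClosed
    ((isClosed_map_eq continuous_fst μ).inter (isClosed_map_eq continuous_snd ρ₀))
    ⟨⟨μ.prod ρ₀, inferInstance⟩, h1, h2⟩
  refine ⟨γ, hγ, le_antisymm (le_iInf₂ fun σ hσ ↦ ?_) (minEnergy_le hγ)⟩
  exact hmin ⟨σ, hσ.isProbabilityMeasure⟩ hσ

theorem IsOptimalPlan.isMinimizer {ρ₀ : Measure Plane} [IsProbabilityMeasure ρ₀]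
    {γ : Measure (Plane × Plane)} (hγ : IsOptimalPlan ρ₀ γ) (h₀ : targetMoment ρ₀ < ∞) :
    IsMinimizer ρ₀ (γ.map Prod.fst) := by
  have := hγ.isProbabilityMeasure
  refine (isMinimizer_iff h₀).2 ⟨mem_P2_of_energy_lt_top hγ.energy_lt_top, fun μ _ ↦ ?_⟩
  exact (minEnergy_le (isTransportPlan_of_map_snd hγ.map_snd)).trans
    (le_iInf₂ fun σ hσ ↦ hγ.energy_le σ hσ.2)

theorem IsMinimizer.exists_isOptimalPlan {ρ₀ ρ : Measure Plane} [IsProbabilityMeasure ρ₀]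
    (hρ : IsMinimizer ρ₀ ρ) (h₀ : ∫⁻ y, ‖y‖ₑ ^ 2 ∂ρ₀ < ∞) (h₁ : targetMoment ρ₀ < ∞) :
    ∃ γ, IsOptimalPlan ρ₀ γ ∧ IsTransportPlan ρ ρ₀ γ ∧ energy γ γ = minEnergy ρ₀ ρ := by
  obtain ⟨hρ2, hmin⟩ := (isMinimizer_iff h₁).1 hρ
  have := hρ2.1
  obtain ⟨σ, hσ⟩ := LogTransport.exists_isOptimalPlan h₀
  have hle : ∀ τ : Measure (Plane × Plane), τ.map Prod.snd = ρ₀ →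
      minEnergy ρ₀ ρ ≤ energy τ τ := fun τ hτ ↦ by
    have hplan := isTransportPlan_of_map_snd hτ
    have := hplan.isProbabilityMeasure
    rcases eq_or_ne (energy τ τ) ∞ with h | h
    · simp [h]
    · exact (hmin _ (mem_P2_of_energy_lt_top h.lt_top)).trans (minEnergy_le hplan)
  obtain ⟨γ, hγ, hγe⟩ := exists_energy_eq_minEnergy ρ₀ ρ
  refine ⟨γ, ⟨hγ.isProbabilityMeasure, hγ.2, ?_, fun τ hτ ↦ hγe.trans_le (hle τ hτ)⟩, hγ, hγe⟩
  exact (hγe.trans_le (hle σ hσ.map_snd)).trans_lt hσ.energy_lt_top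

/-- With the first marginal fixed, energy and transport cost differ by finite constants, so the plan
of least energy is also the cheapest. -/
theorem cost_eq_wassersteinSq {ρ₀ ρ : Measure Plane} [IsProbabilityMeasure ρ₀]
    {γ : Measure (Plane × Plane)} (hρ : ρ ∈ P2) (h₁ : targetMoment ρ₀ < ∞)
    (hγ : IsTransportPlan ρ ρ₀ γ) (hγe : energy γ γ = minEnergy ρ₀ ρ) (hfin : energy γ γ < ∞) :
    2⁻¹ * ∫⁻ p, edist p.1 p.2 ^ 2 ∂γ = wassersteinSq ρ ρ₀ := by
  have e1 := energy_add_logEnergyNeg hγ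
  have e2 := minEnergy_add_logEnergyNeg ρ₀ ρ
  have hsum : logEnergyPos ρ + 2⁻¹ * ∫⁻ p, edist p.1 p.2 ^ 2 ∂γ + targetMoment ρ₀ ≠ ∞ := by
    rw [← e1]
    exact (ENNReal.add_lt_top.2 ⟨hfin, logEnergyNeg_lt_top hρ⟩).ne
  have hP : logEnergyPos ρ ≠ ∞ := fun h ↦ hsum (by simp [h])
  rw [← hγe, e1] at e2
  exact (ENNReal.add_right_inj hP).1 ((ENNReal.add_left_inj h₁.ne).1 e2)

theorem isOptimalTransportMap_of_ae_eq {μ ν : Measure Plane} {γ : Measure (Plane × Plane)}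
    (hγ : IsTransportPlan μ ν γ) {T : Plane → Plane} (hT : Measurable T)
    (hgraph : ∀ᵐ p ∂γ, T p.1 = p.2)
    (hcost : 2⁻¹ * ∫⁻ p, edist p.1 p.2 ^ 2 ∂γ = wassersteinSq μ ν) :
    IsOptimalTransportMap μ ν T := by
  refine ⟨⟨hT, ?_⟩, ?_⟩
  · rw [← hγ.1, Measure.map_map hT measurable_fst, ← hγ.2]
    exact Measure.map_congr hgraph
  · rw [← hcost, ← hγ.1, lintegral_map (by fun_prop) measurable_fst]
    congr 1
    refine lintegral_congr_ae ?_
    filter_upwards [hgraph] with p hp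
    rw [hp]

end LogTransport

end

open LogTransport in
theorem theoremA (ρ₀ : Measure Plane) (hprob : IsProbabilityMeasure ρ₀)
    (hsupp : IsCompact ρ₀.support) :
    (∃ ρ : Measure Plane, IsMinimizer ρ₀ ρ) ∧
    ∀ ρ : Measure Plane, IsMinimizer ρ₀ ρ →
      IsCompact ρ.support ∧ (∀ x : Plane, ρ {x} = 0) ∧
        ∃ T : Plane → Plane, IsOptimalTransportMap ρ ρ₀ T := by
  obtain ⟨R, hR⟩ := hsupp.isBounded.exists_norm_le
  have hR' : ∀ᵐ y ∂ρ₀, ‖y‖ ≤ R := by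
    filter_upwards [Measure.support_mem_ae (μ := ρ₀)] with y hy using hR y hy
  have h₀ : ∫⁻ y, ‖y‖ₑ ^ 2 ∂ρ₀ < ∞ := by
    have h : ∀ᵐ y ∂ρ₀, ‖y‖ₑ ^ 2 ≤ ENNReal.ofReal R ^ 2 := by
      filter_upwards [hR'] with y hy
      rw [← ofReal_norm]
      gcongr
    refine (lintegral_mono_ae h).trans_lt ?_
    simp
  have h₁ : targetMoment ρ₀ < ∞ :=
    ENNReal.add_lt_top.2 ⟨ENNReal.mul_lt_top (by simp) h₀, by simp⟩
  refine ⟨?_, fun ρ hρ ↦ ?_⟩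
  · obtain ⟨γ, hγ⟩ := exists_isOptimalPlan h₀
    exact ⟨_, hγ.isMinimizer h₁⟩
  · obtain ⟨γ, hγ, hplan, hγe⟩ := hρ.exists_isOptimalPlan h₀ h₁
    obtain ⟨T, hT, hgraph⟩ := hγ.exists_map h₀
    have hcost := cost_eq_wassersteinSq hρ.1 h₁ hplan hγe hγ.energy_lt_top
    refine ⟨?_, fun x ↦ ?_, T, isOptimalTransportMap_of_ae_eq hplan hT hgraph hcost⟩
    · rw [← hplan.1]; exact hγ.isCompact_support hR' h₀
    · rw [← hplan.1]; exact hγ.measure_singleton x
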